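/- Let $I$ be a countable set of experts, let $\pi$ be a probability distribution on $I$, and let $n\ge 1$. Let $\Delta(I)$ be the set of all probability distributions on $I$ and let $\mathcal Y=[0,1]^I$; for $f\in\Delta(I)$ and $y\in\mathcal Y$ write $\langle f,y\rangle=\mathbb E_{i\sim f}[y(i)]$, so that $\langle e_i,y\rangle=y(i)$. In each round $t=1,\dots,n$ the learner, knowing $y_1,\dots,y_{t-1}$, chooses a distribution $q_t$ over $\Delta(I)$, the outcome $y_t\in\mathcal Y$ is revealed, and the learner draws $\hat y_t\sim q_t$ and suffers the loss $\langle\hat y_t,y_t\rangle$. Put $$\mathcal B_n(f;y_{1:n})=\sqrt{50\,\bigl(\mathrm{KL}(f|\pi)+\log n\bigr)\sum_{t=1}^n\mathbb E_{i\sim f}\langle e_i,y_t\rangle^2}+50\,\bigl(\mathrm{KL}(f|\pi)+\log n\bigr)+10,$$ which is $+\infty$ when $\mathrm{KL}(f|\pi)=+\infty$. Then the adaptive rate $\mathcal B_n$ is achievable: there is a randomized algorithm for the learner (depending only on $I$, $\pi$ and $n$) such that $$\mathbb E\Bigl[\sum_{t=1}^n\langle\hat y_t,y_t\rangle-\sum_{t=1}^n\langle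 f,y_t\rangle\Bigr]\le\mathcal B_n(f;y_{1:n})\qquad\text{for all }y_1,\dots,y_n\in\mathcal Y\text{ and all }f\in\Delta(I).$$ -/

import Mathlib

open MeasureTheory

noncomputable section

namespace OnlineLearning

/-- A randomized online learning algorithm for `n` rounds: in round `t` it sees the instances up to
and including the current one and all earlier outcomes, and it returns a distribution over
decisions, from which the prediction is drawn. -/
def Algorithm (X D Y : Type*) [MeasurableSpace D] (n : ℕ) : Type _ :=
  (t : Fin n) → (Fin (t + 1) → X) → (Fin t → Y) → ProbabilityMeasure D

/-- The distribution that the algorithm plays in round `t` on the data `x`, `y`. It depends only on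
`x_1, ..., x_t` and `y_1, ..., y_{t-1}`. -/
def Algorithm.play {X D Y : Type*} [MeasurableSpace D] {n : ℕ} (q : Algorithm X D Y n)
    (x : Fin n → X) (y : Fin n → Y) (t : Fin n) : ProbabilityMeasure D :=
  q t (fun s => x (Fin.castLE t.isLt s)) (fun s => y (Fin.castLE t.isLt.le s))

/-- The joint law of the predictions of the algorithm on the data `x`, `y`: in each round the
prediction is drawn afresh from the distribution played in that round. -/
def Algorithm.law {X D Y : Type*} [MeasurableSpace D] {n : ℕ} (q : Algorithm X D Y n)
    (x : Fin n → X) (y : Fin n → Y) : Measure (Fin n → D) :=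
  Measure.pi fun t => (q.play x y t : Measure D)

/-- The adaptive regret bound `B f x y` is achievable for the loss `ℓ` and the class `F`: some
randomized algorithm has expected regret at most `B f x y` on all data sequences and against
all `f ∈ F` simultaneously. -/
def Achievable {X D Y : Type*} [MeasurableSpace D] (ℓ : D → Y → ℝ) (F : Set (X → D)) (n : ℕ)
    (B : (X → D) → (Fin n → X) → (Fin n → Y) → EReal) : Prop :=
  ∃ q : Algorithm X D Y n, ∀ (x : Fin n → X) (y : Fin n → Y),
    Integrable (fun p : Fin n → D => ∑ t, ℓ (p t) (y t)) (q.law x y) ∧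
    ∀ f ∈ F,
      ((∫ p : Fin n → D, ((∑ t, ℓ (p t) (y t)) - ∑ t, ℓ (f (x t)) (y t)) ∂(q.law x y) : ℝ) : EReal)
        ≤ B f x y

/-- The loss `⟨f, y⟩` of a mixture `f` of experts when the expert `i` has loss `y i ∈ [0, 1]`:
the expected loss of an expert drawn from `f`. -/
def mixtureLoss {ι : Type*} [MeasurableSpace ι] (f : ProbabilityMeasure ι)
    (y : ι → Set.Icc (0 : ℝ) 1) : ℝ :=
  ∫ i, (y i : ℝ) ∂(f : Measure ι)

/-- The complexity `KL(f | π) + log n`; it is `∞` when `KL(f | π)` is. -/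
def klComplexity {ι : Type*} [MeasurableSpace ι] (π f : ProbabilityMeasure ι) (n : ℕ) : ENNReal :=
  InformationTheory.klDiv (f : Measure ι) (π : Measure ι) + ENNReal.ofReal (Real.log n)

/-- The optimistic PAC-Bayes rate
`√(50 (KL(f | π) + log n) ∑_t E_{i ∼ f} (y_t i)²) + 50 (KL(f | π) + log n) + 10`. -/
def pacBayesRate {ι : Type*} [MeasurableSpace ι] (π f : ProbabilityMeasure ι) {n : ℕ}
    (y : Fin n → ι → Set.Icc (0 : ℝ) 1) : ENNReal :=
  (50 * klComplexity π f n *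
      ∑ t, ENNReal.ofReal (∫ i, (y t i : ℝ) ^ 2 ∂(f : Measure ι))) ^ (1 / 2 : ℝ)
    + 50 * klComplexity π f n + 10

end OnlineLearning

end

open MeasureTheory

noncomputable section

namespace OnlineLearning

/-! ### Scalar inequalities, the budget equation, and the tuning of the rate -/

section Analysis

/-! The learner is deterministic: it mixes second-order exponential weights over the rates `1 / j`.
Write `M_j` for the prior mass of the weights at rate `1 / j` and let `Φ(l) = -l + ∑ exp (l / j) M_j
/ j`. This is convex in `l`, and `Φ' = 0` is the budget equation of `exists_level`; it says exactly
that the mixture density with coefficients `exp (l / j) / j²` integrates to `1`.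

Each round's loss is at most the drop of `min Φ` (`mixtureLoss_prediction_add_potential_le`).
Initially `min Φ ≤ Φ(0) ≤ ∑ 1 / j ≤ log n`, and finally `min Φ ≥ -l`, so the total loss is at most
`log n + l`. Any single term of the budget is at most `1`, which bounds `l` through `-log M_j`, and
Donsker–Varadhan bounds that by the comparator's loss, its second moment and its KL (`level_le`).
The grid contains a nearly optimal `j` (`exists_rate`).

Starting the grid at `2` gives `y / j ≤ 1 / 2` and `∑ 1 / j² ≤ 1`. -/

lemma exp_neg_sub_sq_le {x : ℝ} (h0 : 0 ≤ x) (h1 : x ≤ 1 / 2) :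
    Real.exp (-(x + x ^ 2)) ≤ 1 - x := by
  have hq := Real.quadratic_le_exp_of_nonneg (x := x + x ^ 2) (by positivity)
  rw [Real.exp_neg, inv_le_comm₀ (Real.exp_pos _) (by linarith)]
  refine le_trans ?_ hq
  rw [inv_le_iff_one_le_mul₀ (by linarith)]
  -- With `u = x + x²`, `(1 - x)(1 + u + u² / 2) - 1` is `x² / 2` times this quantity.
  have h2 : 0 ≤ (1 + x) ^ 2 * (1 - x) - 2 * x := by nlinarith [mul_nonneg h0 h0]
  nlinarith [mul_nonneg (mul_nonneg h0 h0) h2]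

lemma sum_Icc_two_inv_sq_le (N : ℕ) :
    ∑ j ∈ Finset.Icc 2 (N + 2), ((j : ℝ) ^ 2)⁻¹ ≤ 1 - 1 / (N + 2 : ℝ) := by
  induction N with
  | zero => norm_num
  | succ N ih =>
    rw [show N + 1 + 2 = (N + 2) + 1 from rfl, Finset.sum_Icc_succ_top (by omega)]
    have h : (((N + 2 + 1 : ℕ) : ℝ) ^ 2)⁻¹ ≤ 1 / (N + 2 : ℝ) - 1 / (N + 3 : ℝ) := by
      push_cast
      rw [div_sub_div _ _ (by positivity) (by positivity), inv_eq_one_div,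
        div_le_div_iff₀ (by positivity) (by positivity)]
      nlinarith [Nat.cast_nonneg (α := ℝ) N]
    push_cast at h ⊢
    have e : (N + 1 + 2 : ℝ) = N + 3 := by ring
    rw [e]
    linarith

lemma sum_Icc_two_inv_le_log (N : ℕ) :
    ∑ j ∈ Finset.Icc 2 (N + 2), (j : ℝ)⁻¹ ≤ Real.log (N + 2 : ℕ) := by
  have h := harmonic_le_one_add_log (N + 2)
  rw [harmonic_eq_sum_Icc] at h
  push_cast at h
  rw [← Finset.add_sum_Ioc_eq_sum_Icc (by omega)] at h
  have e : Finset.Ioc 1 (N + 2) = Finset.Icc 2 (N + 2) := by ext; simp; omega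
  rw [e] at h
  push_cast
  norm_num at h
  linarith

/-- The exponential budget equation `∑ j, exp (l / j) a_j / j² = 1` is solvable. -/
lemma exists_level (N : ℕ) (a : ℕ → ℝ) (h0 : ∀ j, 0 < a j) (h1 : ∀ j, a j ≤ 1) :
    ∃ l : ℝ, ∑ j ∈ Finset.Icc 2 (N + 2), Real.exp (l / j) * a j / (j : ℝ) ^ 2 = 1 := by
  have hc : Continuous fun l : ℝ =>
      ∑ j ∈ Finset.Icc 2 (N + 2), Real.exp (l / j) * a j / (j : ℝ) ^ 2 := by fun_prop
  -- At `l = B` the term `j = 2` alone equals `1`; at `l = 0` the whole sum is at most `∑ 1 / j² ≤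
  -- 1`.
  set B := 2 * Real.log (4 / a 2) with hB
  refine mem_range_of_exists_le_of_exists_ge hc ⟨0, ?_⟩ ⟨B, ?_⟩
  · calc _ ≤ ∑ j ∈ Finset.Icc 2 (N + 2), ((j : ℝ) ^ 2)⁻¹ := by
          refine Finset.sum_le_sum fun j _ => ?_
          rw [zero_div, Real.exp_zero, one_mul, inv_eq_one_div]
          gcongr
          exact h1 j
      _ ≤ 1 := (sum_Icc_two_inv_sq_le N).trans (by
          have : (0 : ℝ) ≤ 1 / (N + 2 : ℝ) := by positivity
          linarith)
  · have hs := Finset.single_le_sum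
      (f := fun j : ℕ => Real.exp (B / j) * a j / (j : ℝ) ^ 2) (s := Finset.Icc 2 (N + 2))
      (fun j _ => by have := h0 j; positivity) (a := 2) (by simp)
    refine le_trans (le_of_eq ?_) hs
    have h2 := h0 2
    have e : B / (2 : ℕ) = Real.log (4 / a 2) := by rw [hB]; push_cast; ring
    simp only [e]
    rw [Real.exp_log (by positivity)]
    push_cast
    field_simp
    norm_num

/-- Tuning the learning rate `1 / j` on the grid `2 ≤ j ≤ n`. -/
lemma exists_rate {n : ℕ} (hn : 3 ≤ n) {κ V : ℝ} (hκ : 0 ≤ κ) (hV : 0 ≤ V) (hVn : V ≤ n) :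
    ∃ j ∈ Finset.Icc 2 n, Real.log n + j * (κ + 2 * Real.log j) + V / j ≤
      Real.sqrt (50 * (κ + Real.log n) * V) + 50 * (κ + Real.log n) := by
  have hn' : (3 : ℝ) ≤ n := by exact_mod_cast hn
  have hlog : 1 ≤ Real.log n := by
    rw [Real.le_log_iff_exp_le (by linarith)]
    linarith [Real.exp_one_lt_d9]
  set C := κ + Real.log n with hC
  have hC1 : 1 ≤ C := by linarith
  -- `s` balances `j * C` against `V / j`; both are then of order `s * C = √(C * V)`.
  set s := Real.sqrt (V / C) with hs
  have hs0 : 0 ≤ s := Real.sqrt_nonneg _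
  have hsV : V = s ^ 2 * C := by
    rw [hs, Real.sq_sqrt (by positivity)]
    field_simp
  have hroot : 7 * (s * C) ≤ Real.sqrt (50 * C * V) := by
    apply Real.le_sqrt_of_sq_le
    rw [hsV]
    nlinarith [sq_nonneg (s * C)]
  have hlogj : ∀ j : ℕ, 2 ≤ j → j ≤ n → κ + 2 * Real.log j ≤ 2 * C := by
    intro j h2 hj
    have : Real.log j ≤ Real.log n := Real.log_le_log (by positivity) (by exact_mod_cast hj)
    linarith
  rcases le_or_gt s 2 with h | h
  · refine ⟨2, Finset.mem_Icc.2 ⟨le_rfl, by omega⟩, ?_⟩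
    have h1 := hlogj 2 le_rfl (by omega)
    have h3 : V ≤ 4 * C := by
      rw [hsV]
      exact mul_le_mul_of_nonneg_right (by nlinarith) (by linarith)
    have h4 : 0 ≤ s * C := by positivity
    push_cast at h1 ⊢
    linarith
  · have hj1 := Nat.le_ceil s
    have hj2 := Nat.ceil_lt_add_one hs0
    -- Since `C ≥ 1`, `s² ≤ V ≤ n`, and `s > 2` gives `s ≤ s²`.
    have hjn : ⌈s⌉₊ ≤ n := by
      refine Nat.ceil_le.2 ?_
      have : s ^ 2 ≤ n := by nlinarith [sq_nonneg s]
      nlinarith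
    have h2j : 2 ≤ ⌈s⌉₊ := by
      have : (2 : ℝ) < ⌈s⌉₊ := h.trans_le hj1
      exact_mod_cast this.le
    refine ⟨⌈s⌉₊, Finset.mem_Icc.2 ⟨h2j, hjn⟩, ?_⟩
    have h1 := hlogj _ h2j hjn
    set r : ℝ := (⌈s⌉₊ : ℝ)
    have h3 : V / r ≤ s * C := by
      rw [div_le_iff₀ (by linarith), hsV]
      have : 0 ≤ s * C := by positivity
      nlinarith
    have h4 : r * (κ + 2 * Real.log r) ≤ (3 / 2 * s) * (2 * C) := by
      have hl : 0 ≤ Real.log r := Real.log_nonneg (by linarith)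
      exact mul_le_mul (by linarith) h1 (by linarith) (by linarith)
    have h5 : 0 ≤ s * C := by positivity
    linarith

end Analysis

/-! ### Change of measure -/

section DonskerVaradhan

open InformationTheory

/-- The Donsker–Varadhan inequality. -/
lemma integral_le_toReal_klDiv_add_log {α : Type*} [MeasurableSpace α] {μ ν : Measure α}
    [IsProbabilityMeasure μ] [IsProbabilityMeasure ν] (h : klDiv μ ν ≠ ⊤) {g : α → ℝ}
    (hgμ : Integrable g μ) (hgν : Integrable (fun a => Real.exp (g a)) ν) :
    ∫ a, g a ∂μ ≤ (klDiv μ ν).toReal + Real.log (∫ a, Real.exp (g a) ∂ν) := by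
  obtain ⟨hac, hint⟩ := klDiv_ne_top_iff.1 h
  have : IsProbabilityMeasure (ν.tilted g) := isProbabilityMeasure_tilted hgν
  -- The gap in the inequality is the divergence of `μ` from the tilted measure, which is
  -- nonnegative.
  have h1 := integral_llr_tilted_right hac hgμ hgν hint
  have h2 := integral_llr_add_sub_measure_univ_nonneg
    (hac.trans (absolutelyContinuous_tilted hgν)) (integrable_llr_tilted_right hac hgμ hint hgν)
  rw [toReal_klDiv hac hint]
  simp only [probReal_univ] at h2 ⊢
  linarith

end DonskerVaradhan

/-! ### Deterministic play as a product of Dirac measures -/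

section Dirac

lemma pi_dirac {κ : Type*} [Fintype κ] {D : Type*} [MeasurableSpace D] (p : κ → D) :
    Measure.pi (fun k => Measure.dirac (p k)) = Measure.dirac p := by
  classical
  refine Measure.pi_eq fun s hs => ?_
  rw [Measure.dirac_apply' _ (MeasurableSet.univ_pi hs)]
  simp only [Measure.dirac_apply' _ (hs _), Set.indicator_apply, Pi.one_apply, Set.mem_univ_pi]
  rw [Finset.prod_ite_zero]
  simp

end Dirac

/-! ### Second-order exponential weights and their masses -/

variable {ι : Type*}

/-- The weight of an expert with losses `y` at the learning rate `1 / j`. -/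
def expWeight (j : ℕ) {t : ℕ} (y : Fin t → ι → Set.Icc (0 : ℝ) 1) (i : ι) : ℝ :=
  Real.exp (-∑ s, ((y s i : ℝ) / j + ((y s i : ℝ) / j) ^ 2))

lemma expWeight_pos (j : ℕ) {t : ℕ} (y : Fin t → ι → Set.Icc (0 : ℝ) 1) (i : ι) :
    0 < expWeight j y i := Real.exp_pos _

lemma expWeight_le_one (j : ℕ) {t : ℕ} (y : Fin t → ι → Set.Icc (0 : ℝ) 1) (i : ι) :
    expWeight j y i ≤ 1 := by
  refine Real.exp_le_one_iff.2 (neg_nonpos.2 (Finset.sum_nonneg fun s _ => ?_))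
  have := (y s i).2.1
  positivity

variable [MeasurableSpace ι]

lemma mixtureLoss_nonneg (f : ProbabilityMeasure ι) (y : ι → Set.Icc (0 : ℝ) 1) :
    0 ≤ mixtureLoss f y := integral_nonneg fun i => (y i).2.1

variable [DiscreteMeasurableSpace ι]

lemma integrable_of_abs_le (μ : Measure ι) [IsFiniteMeasure μ] {g : ι → ℝ} {C : ℝ}
    (h : ∀ i, |g i| ≤ C) : Integrable g μ :=
  Integrable.of_bound Measurable.of_discrete.aestronglyMeasurable C (ae_of_all _ h)

lemma measurable_mixtureLoss (y : ι → Set.Icc (0 : ℝ) 1) :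
    Measurable fun f : ProbabilityMeasure ι => mixtureLoss f y := by
  have h : (fun f : ProbabilityMeasure ι => mixtureLoss f y) =
      fun f : ProbabilityMeasure ι => (∫⁻ i, ENNReal.ofReal (y i) ∂(f : Measure ι)).toReal := by
    funext f
    exact integral_eq_lintegral_of_nonneg_ae (ae_of_all _ fun i => (y i).2.1)
      Measurable.of_discrete.aestronglyMeasurable
  rw [h]
  exact ((Measure.measurable_lintegral Measurable.of_discrete).comp
    measurable_subtype_coe).ennreal_toReal

lemma mixtureLoss_le_one (f : ProbabilityMeasure ι) (y : ι → Set.Icc (0 : ℝ) 1) :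
    mixtureLoss f y ≤ 1 := by
  have h := integral_mono (μ := (f : Measure ι)) (f := fun i => (y i : ℝ)) (g := fun _ => 1)
    (integrable_of_abs_le _ (C := 1) fun i => by
      rw [abs_of_nonneg (y i).2.1]; exact (y i).2.2)
    (integrable_const _) (fun i => (y i).2.2)
  simpa [mixtureLoss] using h

lemma integrable_expWeight (π : Measure ι) [IsFiniteMeasure π] (j : ℕ) {t : ℕ}
    (y : Fin t → ι → Set.Icc (0 : ℝ) 1) : Integrable (expWeight j y) π :=
  integrable_of_abs_le _ (C := 1) fun i => by
    rw [abs_of_pos (expWeight_pos j y i)]; exact expWeight_le_one j y i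

lemma integrable_expWeight_mul (π : Measure ι) [IsFiniteMeasure π] (j : ℕ) {t : ℕ}
    (y : Fin t → ι → Set.Icc (0 : ℝ) 1) (z : ι → Set.Icc (0 : ℝ) 1) :
    Integrable (fun i => expWeight j y i * z i) π :=
  integrable_of_abs_le _ (C := 1) fun i => by
    rw [abs_of_nonneg (mul_nonneg (expWeight_pos j y i).le (z i).2.1)]
    exact mul_le_one₀ (expWeight_le_one j y i) (z i).2.1 (z i).2.2

/-- The total weight of all experts at the learning rate `1 / j`. -/
def expMass (π : ProbabilityMeasure ι) (j : ℕ) {t : ℕ} (y : Fin t → ι → Set.Icc (0 : ℝ) 1) : ℝ :=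
  ∫ i, expWeight j y i ∂(π : Measure ι)

lemma expMass_pos (π : ProbabilityMeasure ι) (j : ℕ) {t : ℕ}
    (y : Fin t → ι → Set.Icc (0 : ℝ) 1) : 0 < expMass π j y := by
  unfold expMass expWeight
  exact integral_exp_pos (integrable_expWeight _ j y)

lemma expMass_le_one (π : ProbabilityMeasure ι) (j : ℕ) {t : ℕ}
    (y : Fin t → ι → Set.Icc (0 : ℝ) 1) : expMass π j y ≤ 1 := by
  have h := integral_mono (integrable_expWeight (π : Measure ι) j y) (integrable_const 1)
    (fun i => expWeight_le_one j y i)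
  simpa [expMass] using h

/-- The loss of any round is paid for by the decrease of the total weight. -/
lemma expMass_succ_le (π : ProbabilityMeasure ι) {j : ℕ} (hj : 2 ≤ j) {t : ℕ}
    (y : Fin (t + 1) → ι → Set.Icc (0 : ℝ) 1) :
    expMass π j y ≤ expMass π j (fun s : Fin t => y s.castSucc) -
      (∫ i, expWeight j (fun s : Fin t => y s.castSucc) i * y (Fin.last t) i ∂(π : Measure ι)) / j := by
  have hj' : (2 : ℝ) ≤ j := by exact_mod_cast hj
  unfold expMass
  rw [← integral_div, ← integral_sub (integrable_expWeight _ _ _)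
    ((integrable_expWeight_mul _ _ _ _).div_const _)]
  refine integral_mono (integrable_expWeight _ _ _) ((integrable_expWeight _ _ _).sub
    ((integrable_expWeight_mul _ _ _ _).div_const _)) fun i => ?_
  obtain ⟨h0, h1⟩ := (y (Fin.last t) i).2
  have hx : (y (Fin.last t) i : ℝ) / j ≤ 1 / 2 := by
    rw [div_le_div_iff₀ (by linarith) (by norm_num)]
    linarith
  have h := mul_le_mul_of_nonneg_left (exp_neg_sub_sq_le (by positivity) hx)
    (expWeight_pos j (fun s : Fin t => y s.castSucc) i).le
  have e : expWeight j y i = expWeight j (fun s : Fin t => y s.castSucc) i *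
      Real.exp (-((y (Fin.last t) i : ℝ) / j + ((y (Fin.last t) i : ℝ) / j) ^ 2)) := by
    rw [expWeight, expWeight, ← Real.exp_add, Fin.sum_univ_castSucc, neg_add]
  rw [e]
  refine h.trans (le_of_eq ?_)
  ring

/-! ### The mixture over learning rates -/

/-- The normalizing level of the mixture over all learning rates. -/
def level (π : ProbabilityMeasure ι) (N : ℕ) {t : ℕ} (y : Fin t → ι → Set.Icc (0 : ℝ) 1) : ℝ :=
  (exists_level N (fun j => expMass π j y) (fun j => expMass_pos π j y)
    (fun j => expMass_le_one π j y)).choose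

lemma sum_level (π : ProbabilityMeasure ι) (N : ℕ) {t : ℕ}
    (y : Fin t → ι → Set.Icc (0 : ℝ) 1) :
    ∑ j ∈ Finset.Icc 2 (N + 2),
      Real.exp (level π N y / j) * expMass π j y / (j : ℝ) ^ 2 = 1 :=
  (exists_level N (fun j => expMass π j y) (fun j => expMass_pos π j y)
    (fun j => expMass_le_one π j y)).choose_spec

/-- The density, with respect to the prior, of the prediction after the losses `y`. -/
def density (π : ProbabilityMeasure ι) (N : ℕ) {t : ℕ} (y : Fin t → ι → Set.Icc (0 : ℝ) 1)
    (i : ι) : ℝ :=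
  ∑ j ∈ Finset.Icc 2 (N + 2), Real.exp (level π N y / j) / (j : ℝ) ^ 2 * expWeight j y i

lemma density_nonneg (π : ProbabilityMeasure ι) (N : ℕ) {t : ℕ}
    (y : Fin t → ι → Set.Icc (0 : ℝ) 1) (i : ι) : 0 ≤ density π N y i :=
  Finset.sum_nonneg fun j _ => mul_nonneg (by positivity) (expWeight_pos j y i).le

lemma integrable_density (π : ProbabilityMeasure ι) (N : ℕ) {t : ℕ}
    (y : Fin t → ι → Set.Icc (0 : ℝ) 1) : Integrable (density π N y) (π : Measure ι) :=
  integrable_finsetSum _ fun j _ => (integrable_expWeight _ j y).const_mul _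

lemma integral_density (π : ProbabilityMeasure ι) (N : ℕ) {t : ℕ}
    (y : Fin t → ι → Set.Icc (0 : ℝ) 1) : ∫ i, density π N y i ∂(π : Measure ι) = 1 := by
  unfold density
  rw [integral_finsetSum _ fun j _ => (integrable_expWeight _ j y).const_mul _,
    ← sum_level π N y]
  refine Finset.sum_congr rfl fun j _ => ?_
  rw [integral_const_mul, expMass]
  ring

/-- The mixture of experts predicted after the losses `y`: exponential weights, mixed over the
learning rates `1 / j`. -/
def prediction (π : ProbabilityMeasure ι) (N : ℕ) {t : ℕ} (y : Fin t → ι → Set.Icc (0 : ℝ) 1) :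
    ProbabilityMeasure ι :=
  ⟨(π : Measure ι).withDensity fun i => ENNReal.ofReal (density π N y i), ⟨by
    rw [withDensity_apply _ MeasurableSet.univ, Measure.restrict_univ,
      ← ofReal_integral_eq_lintegral_ofReal (integrable_density π N y)
        (ae_of_all _ (density_nonneg π N y)), integral_density, ENNReal.ofReal_one]⟩⟩

lemma mixtureLoss_prediction (π : ProbabilityMeasure ι) (N : ℕ) {t : ℕ}
    (y : Fin t → ι → Set.Icc (0 : ℝ) 1) (z : ι → Set.Icc (0 : ℝ) 1) :
    mixtureLoss (prediction π N y) z = ∑ j ∈ Finset.Icc 2 (N + 2),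
      Real.exp (level π N y / j) / (j : ℝ) ^ 2 *
        ∫ i, expWeight j y i * z i ∂(π : Measure ι) := by
  unfold mixtureLoss prediction
  rw [ProbabilityMeasure.coe_mk, integral_withDensity_eq_integral_toReal_smul
    Measurable.of_discrete (ae_of_all _ fun _ => ENNReal.ofReal_lt_top)]
  simp only [ENNReal.toReal_ofReal (density_nonneg π N y _), smul_eq_mul]
  simp only [density, Finset.sum_mul, mul_assoc]
  rw [integral_finsetSum _ fun j _ => (integrable_expWeight_mul _ j y z).const_mul _]
  simp only [integral_const_mul]

/-! ### The potential argument -/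

/-- The potential at the losses `y`, as a function of the level. -/
def potential (π : ProbabilityMeasure ι) (N : ℕ) {t : ℕ} (y : Fin t → ι → Set.Icc (0 : ℝ) 1)
    (l : ℝ) : ℝ :=
  -l + ∑ j ∈ Finset.Icc 2 (N + 2), Real.exp (l / j) * expMass π j y / j

/-- The potential lies above its tangent at the level, termwise by `1 + x ≤ exp x`, and the budget
equation makes that tangent horizontal. -/
lemma potential_level_le (π : ProbabilityMeasure ι) (N : ℕ) {t : ℕ}
    (y : Fin t → ι → Set.Icc (0 : ℝ) 1) (l : ℝ) :
    potential π N y (level π N y) ≤ potential π N y l := by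
  set l₀ := level π N y with hl
  have h : ∑ j ∈ Finset.Icc 2 (N + 2), (Real.exp (l₀ / j) * expMass π j y / j +
      (l - l₀) * (Real.exp (l₀ / j) * expMass π j y / (j : ℝ) ^ 2)) ≤
      ∑ j ∈ Finset.Icc 2 (N + 2), Real.exp (l / j) * expMass π j y / j := by
    refine Finset.sum_le_sum fun j hj => ?_
    have hj0 : (0 : ℝ) < j := by
      have := (Finset.mem_Icc.1 hj).1
      positivity
    have h1 := Real.add_one_le_exp ((l - l₀) / j)
    have h2 : Real.exp (l / j) = Real.exp (l₀ / j) * Real.exp ((l - l₀) / j) := by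
      rw [← Real.exp_add]; congr 1; ring
    have h3 : 0 ≤ Real.exp (l₀ / j) * expMass π j y / j := by
      have := expMass_pos π j y
      positivity
    have h4 := mul_le_mul_of_nonneg_left h1 h3
    rw [h2]
    calc _ = Real.exp (l₀ / j) * expMass π j y / j * ((l - l₀) / j + 1) := by
          field_simp
          ring
      _ ≤ _ := h4
      _ = _ := by ring
  rw [Finset.sum_add_distrib, ← Finset.mul_sum, sum_level] at h
  unfold potential
  linarith

/-- By minimality the new potential may be evaluated at the old level. There the masses drop by the
amounts in `expMass_succ_le`, which, weighted by `exp (l / j) / j`, add up to the mixture's loss. -/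
lemma mixtureLoss_prediction_add_potential_le (π : ProbabilityMeasure ι) (N : ℕ) {t : ℕ}
    (y : Fin (t + 1) → ι → Set.Icc (0 : ℝ) 1) :
    mixtureLoss (prediction π N fun s : Fin t => y s.castSucc) (y (Fin.last t)) +
      potential π N y (level π N y) ≤
    potential π N (fun s : Fin t => y s.castSucc) (level π N fun s : Fin t => y s.castSucc) := by
  set y' : Fin t → ι → Set.Icc (0 : ℝ) 1 := fun s => y s.castSucc
  have h := potential_level_le π N y (level π N y')
  rw [mixtureLoss_prediction]
  have h2 : ∑ j ∈ Finset.Icc 2 (N + 2), Real.exp (level π N y' / j) * expMass π j y / j ≤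
      ∑ j ∈ Finset.Icc 2 (N + 2), (Real.exp (level π N y' / j) * expMass π j y' / j -
        Real.exp (level π N y' / j) / (j : ℝ) ^ 2 *
          ∫ i, expWeight j y' i * y (Fin.last t) i ∂(π : Measure ι)) := by
    refine Finset.sum_le_sum fun j hj => ?_
    have h3 := expMass_succ_le π (Finset.mem_Icc.1 hj).1 y
    have h4 := mul_le_mul_of_nonneg_left h3
      (show 0 ≤ Real.exp (level π N y' / j) / j by positivity)
    calc _ = Real.exp (level π N y' / j) / j * expMass π j y := by ring
      _ ≤ _ := h4
      _ = _ := by ring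
  rw [Finset.sum_sub_distrib] at h2
  unfold potential at h ⊢
  linarith

lemma sum_mixtureLoss_prediction_add_potential_le (π : ProbabilityMeasure ι) (N : ℕ) {n : ℕ}
    (y : Fin n → ι → Set.Icc (0 : ℝ) 1) :
    ∑ t : Fin n, mixtureLoss
        (prediction π N fun s : Fin t => y (Fin.castLE t.isLt.le s)) (y t) +
      potential π N y (level π N y) ≤ Real.log (N + 2 : ℕ) := by
  induction n with
  | zero =>
    rw [Fin.sum_univ_zero, zero_add]
    refine ((potential_level_le π N y 0).trans ?_).trans (sum_Icc_two_inv_le_log N)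
    rw [potential, neg_zero, zero_add]
    refine Finset.sum_le_sum fun j _ => ?_
    rw [zero_div, Real.exp_zero, one_mul, inv_eq_one_div]
    gcongr
    exact expMass_le_one π j y
  | succ n ih =>
    have h1 := ih fun s => y s.castSucc
    have h2 := mixtureLoss_prediction_add_potential_le π N y
    rw [Fin.sum_univ_castSucc]
    exact le_trans (by rw [add_assoc]; exact add_le_add_right h2 _) h1

/-- Only here does the comparator enter: one term of the budget equation bounds the level by `j (2
log j - log M_j)`, and Donsker–Varadhan with the log-weight as test function bounds `log M_j` from
below. -/
lemma level_le (π f : ProbabilityMeasure ι)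
    (hf : InformationTheory.klDiv (f : Measure ι) (π : Measure ι) ≠ ⊤) {N j : ℕ}
    (hj : j ∈ Finset.Icc 2 (N + 2)) {n : ℕ} (y : Fin n → ι → Set.Icc (0 : ℝ) 1) :
    level π N y ≤ ∑ t, mixtureLoss f (y t) +
      j * ((InformationTheory.klDiv (f : Measure ι) (π : Measure ι)).toReal + 2 * Real.log j) +
      (∑ t, ∫ i, (y t i : ℝ) ^ 2 ∂(f : Measure ι)) / j := by
  have hj0 : (0 : ℝ) < j := by
    have := (Finset.mem_Icc.1 hj).1
    positivity
  have hy : ∀ t, Integrable (fun i => (y t i : ℝ)) (f : Measure ι) := fun t =>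
    integrable_of_abs_le _ (C := 1) fun i => by
      rw [abs_of_nonneg (y t i).2.1]; exact (y t i).2.2
  have hy2 : ∀ t, Integrable (fun i => (y t i : ℝ) ^ 2) (f : Measure ι) := fun t =>
    integrable_of_abs_le _ (C := 1) fun i => by
      rw [abs_of_nonneg (sq_nonneg _)]; exact pow_le_one₀ (y t i).2.1 (y t i).2.2
  have hint : ∀ t, Integrable (fun i => (y t i : ℝ) / j + ((y t i : ℝ) / j) ^ 2)
      (f : Measure ι) := fun t => by
    simp only [div_pow]
    exact ((hy t).div_const _).add ((hy2 t).div_const _)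
  have hdv := integral_le_toReal_klDiv_add_log hf
    (g := fun i => -∑ s, ((y s i : ℝ) / j + ((y s i : ℝ) / j) ^ 2))
    (integrable_finsetSum _ fun t _ => hint t).neg (integrable_expWeight _ j y)
  have hM : Real.log (∫ i, Real.exp (-∑ s, ((y s i : ℝ) / j + ((y s i : ℝ) / j) ^ 2))
      ∂(π : Measure ι)) ≤ 2 * Real.log j - level π N y / j := by
    change Real.log (expMass π j y) ≤ _
    have hm := expMass_pos π j y
    have h1 := Finset.single_le_sum
      (f := fun j : ℕ => Real.exp (level π N y / j) * expMass π j y / (j : ℝ) ^ 2)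
      (s := Finset.Icc 2 (N + 2))
      (fun k _ => by have := expMass_pos π k y; positivity) hj
    rw [sum_level] at h1
    have h2 := Real.log_le_log (by positivity) h1
    rw [Real.log_one, Real.log_div (by positivity) (by positivity),
      Real.log_mul (Real.exp_pos _).ne' hm.ne', Real.log_exp, Real.log_pow] at h2
    push_cast at h2
    linarith
  have hE : ∫ i, -∑ s, ((y s i : ℝ) / j + ((y s i : ℝ) / j) ^ 2) ∂(f : Measure ι) =
      -((∑ t, mixtureLoss f (y t)) / j +
        (∑ t, ∫ i, (y t i : ℝ) ^ 2 ∂(f : Measure ι)) / j ^ 2) := by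
    rw [integral_neg, integral_finsetSum _ fun t _ => hint t, Finset.sum_div, Finset.sum_div,
      ← Finset.sum_add_distrib]
    congr 1
    refine Finset.sum_congr rfl fun t _ => ?_
    simp only [div_pow]
    rw [integral_add ((hy t).div_const _) ((hy2 t).div_const _), integral_div, integral_div,
      mixtureLoss]
  rw [hE] at hdv
  have h : level π N y / j ≤ (∑ t, mixtureLoss f (y t)) / j +
      (∑ t, ∫ i, (y t i : ℝ) ^ 2 ∂(f : Measure ι)) / j ^ 2 +
      (InformationTheory.klDiv (f : Measure ι) (π : Measure ι)).toReal + 2 * Real.log j := by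
    linarith
  rw [div_le_iff₀ hj0] at h
  refine h.trans (le_of_eq ?_)
  field_simp
  ring

lemma sum_mixtureLoss_prediction_le (π f : ProbabilityMeasure ι)
    (hf : InformationTheory.klDiv (f : Measure ι) (π : Measure ι) ≠ ⊤) {N j : ℕ}
    (hj : j ∈ Finset.Icc 2 (N + 2)) {n : ℕ} (y : Fin n → ι → Set.Icc (0 : ℝ) 1) :
    ∑ t : Fin n, mixtureLoss
        (prediction π N fun s : Fin t => y (Fin.castLE t.isLt.le s)) (y t) -
      ∑ t, mixtureLoss f (y t) ≤ Real.log (N + 2 : ℕ) +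
      j * ((InformationTheory.klDiv (f : Measure ι) (π : Measure ι)).toReal + 2 * Real.log j) +
      (∑ t, ∫ i, (y t i : ℝ) ^ 2 ∂(f : Measure ι)) / j := by
  have h1 := sum_mixtureLoss_prediction_add_potential_le π N y
  have h2 := level_le π f hf hj y
  have h3 : 0 ≤ ∑ j ∈ Finset.Icc 2 (N + 2),
      Real.exp (level π N y / j) * expMass π j y / j := Finset.sum_nonneg fun k _ => by
    have := expMass_pos π k y
    positivity
  unfold potential at h1
  linarith

/-- The regret of the predictions is bounded by the optimistic PAC-Bayes rate. -/
lemma regret_prediction_le (π f : ProbabilityMeasure ι) {n : ℕ}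
    (y : Fin n → ι → Set.Icc (0 : ℝ) 1) :
    ((∑ t : Fin n, mixtureLoss
        (prediction π (n - 2) fun s : Fin t => y (Fin.castLE t.isLt.le s)) (y t) -
      ∑ t, mixtureLoss f (y t) : ℝ) : EReal) ≤ (pacBayesRate π f y : EReal) := by
  rcases eq_or_ne (InformationTheory.klDiv (f : Measure ι) (π : Measure ι)) ⊤ with hf | hf
  -- The term under the root may be `⊤ * 0 = 0`; the linear term is infinite regardless.
  · have : pacBayesRate π f y = ⊤ := by
      simp [pacBayesRate, klComplexity, hf, ENNReal.mul_top]
    rw [this]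
    exact le_top
  set R := ∑ t : Fin n, mixtureLoss
        (prediction π (n - 2) fun s : Fin t => y (Fin.castLE t.isLt.le s)) (y t) -
      ∑ t, mixtureLoss f (y t) with hR
  set κ := (InformationTheory.klDiv (f : Measure ι) (π : Measure ι)).toReal with hκ
  set V := ∑ t, ∫ i, (y t i : ℝ) ^ 2 ∂(f : Measure ι) with hV
  have hlog : 0 ≤ Real.log n := Real.log_natCast_nonneg n
  have hκ0 : 0 ≤ κ := ENNReal.toReal_nonneg
  have hV0 : 0 ≤ V := Finset.sum_nonneg fun t _ => integral_nonneg fun i => sq_nonneg _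
  have hVn : V ≤ n := by
    calc V ≤ ∑ _t : Fin n, (1 : ℝ) := Finset.sum_le_sum fun t _ => by
          have h := integral_mono (μ := (f : Measure ι)) (f := fun i => (y t i : ℝ) ^ 2)
            (g := fun _ => 1)
            (integrable_of_abs_le _ (C := 1) fun i => by
              rw [abs_of_nonneg (sq_nonneg _)]; exact pow_le_one₀ (y t i).2.1 (y t i).2.2)
            (integrable_const _) (fun i => pow_le_one₀ (y t i).2.1 (y t i).2.2)
          simpa using h
      _ = n := by simp
  have hreal : R ≤ Real.sqrt (50 * (κ + Real.log n) * V) + 50 * (κ + Real.log n) + 10 := by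
    rcases le_or_gt 3 n with h3 | h3
    · obtain ⟨j, hj, hle⟩ := exists_rate h3 hκ0 hV0 hVn
      have hN : n - 2 + 2 = n := by omega
      have h := sum_mixtureLoss_prediction_le π f hf (N := n - 2) (j := j) (by rwa [hN]) y
      rw [hN] at h
      linarith
    -- For `n ≤ 2` the trivial bound `R ≤ n` is absorbed by the constant `10`.
    · have h1 : R ≤ n := by
        have ha : ∑ t : Fin n, mixtureLoss
            (prediction π (n - 2) fun s : Fin t => y (Fin.castLE t.isLt.le s)) (y t) ≤ n := by
          calc _ ≤ ∑ _t : Fin n, (1 : ℝ) :=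
                Finset.sum_le_sum fun t _ => mixtureLoss_le_one _ _
            _ = n := by simp
        have hb : 0 ≤ ∑ t, mixtureLoss f (y t) :=
          Finset.sum_nonneg fun t _ => mixtureLoss_nonneg _ _
        linarith
      have h2 : (n : ℝ) ≤ 3 := by exact_mod_cast h3.le
      have := Real.sqrt_nonneg (50 * (κ + Real.log n) * V)
      linarith
  have hrate : pacBayesRate π f y = ENNReal.ofReal
      (Real.sqrt (50 * (κ + Real.log n) * V) + 50 * (κ + Real.log n) + 10) := by
    have hC : klComplexity π f n = ENNReal.ofReal (κ + Real.log n) := by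
      rw [klComplexity, ENNReal.ofReal_add hκ0 hlog, hκ, ENNReal.ofReal_toReal hf]
    have h50 : (50 : ENNReal) = ENNReal.ofReal 50 := by simp
    have h10 : (10 : ENNReal) = ENNReal.ofReal 10 := by simp
    rw [pacBayesRate, hC, ← ENNReal.ofReal_sum_of_nonneg
      (fun t _ => integral_nonneg fun i => sq_nonneg _), ← hV, h50, h10,
      ← ENNReal.ofReal_mul (by norm_num), ← ENNReal.ofReal_mul (by positivity),
      ENNReal.ofReal_rpow_of_nonneg (by positivity) (by norm_num), ← Real.sqrt_eq_rpow,
      ← ENNReal.ofReal_add (by positivity) (by positivity),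
      ← ENNReal.ofReal_add (by positivity) (by positivity)]
  rw [hrate, EReal.coe_ennreal_ofReal, max_eq_left (by positivity)]
  exact_mod_cast hreal

end OnlineLearning

end

theorem mainTheorem6 {ι : Type*} [Countable ι] [MeasurableSpace ι] [DiscreteMeasurableSpace ι]
    (π : MeasureTheory.ProbabilityMeasure ι) (n : ℕ) (hn : 1 ≤ n) :
    OnlineLearning.Achievable (X := Unit) (D := MeasureTheory.ProbabilityMeasure ι)
      (Y := ι → Set.Icc (0 : ℝ) 1) OnlineLearning.mixtureLoss Set.univ n
      (fun f _ y => (OnlineLearning.pacBayesRate π (f ()) y : EReal)) := by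
  refine ⟨fun t _ y => ⟨Measure.dirac (OnlineLearning.prediction π (n - 2) y), inferInstance⟩,
    fun x y => ?_⟩
  have hlaw : OnlineLearning.Algorithm.law (X := Unit) (n := n)
      (fun t _ y => ⟨Measure.dirac (OnlineLearning.prediction π (n - 2) y), inferInstance⟩) x y =
      Measure.dirac fun t : Fin n =>
        OnlineLearning.prediction π (n - 2) fun s : Fin t => y (Fin.castLE t.isLt.le s) :=
    OnlineLearning.pi_dirac _
  have hmeas : Measurable fun p : Fin n → ProbabilityMeasure ι =>
      ∑ t, OnlineLearning.mixtureLoss (p t) (y t) :=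
    Finset.measurable_sum _ fun t _ =>
      (OnlineLearning.measurable_mixtureLoss (y t)).comp (measurable_pi_apply t)
  rw [hlaw]
  -- Under a Dirac law the expected regret is the regret of the predictions themselves.
  refine ⟨integrable_dirac' hmeas.stronglyMeasurable enorm_lt_top, fun f _ => ?_⟩
  rw [integral_dirac' _ _ (hmeas.sub_const _).stronglyMeasurable]
  exact OnlineLearning.regret_prediction_le π (f ()) y
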